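/- Let $G$ be a finite simple graph of order $n\ge 1$. For an Abelian group $\mathcal{G}$ and a labeling $f:E(G)\to\mathcal{G}$, the weighted degree of a vertex $v$ is $w(v)=\sum_{u\in N(v)}f(uv)$, and $f$ is called $\mathcal{G}$-irregular if the weighted degrees of all the vertices are distinct. The group irregularity strength $s_g(G)$ is the smallest positive integer $s$ such that for every Abelian group $\mathcal{G}$ of order $s$ there exists a $\mathcal{G}$-irregular labeling of $G$ (and $s_g(G)=\infty$ if there is no such $s$). Theorem. Let $G$ be a disconnected graph of order $n$ in which every component has order divisible by $4$ and every bipartite component has both color classes of even order. Then $s_g(G)=n$. -/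

import Mathlib

namespace GroupIrregularity

variable {V : Type*} [Fintype V]

/-- The weighted degree of `v` under the edge labeling `f`: the sum of the labels of the
edges `uv` over all neighbours `u` of `v`. -/
noncomputable def weightedDegree (G : SimpleGraph V) {A : Type*} [AddCommGroup A]
    (f : G.edgeSet → A) (v : V) : A :=
  open Classical in ∑ u : G.neighborSet v, f ⟨s(v, (u : V)), u.2⟩

/-- An edge labeling is irregular if all weighted degrees are distinct. -/
def IsIrregularLabeling (G : SimpleGraph V) {A : Type*} [AddCommGroup A]
    (f : G.edgeSet → A) : Prop :=
  Function.Injective (weightedDegree G f)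

/-- Every Abelian group of order `s` admits an irregular labeling of `G`.
(Every finite group is isomorphic to one whose carrier lives in `Type`.) -/
def AdmitsAllOfOrder (G : SimpleGraph V) (s : ℕ) : Prop :=
  ∀ (A : Type) [AddCommGroup A], Nat.card A = s →
    ∃ f : G.edgeSet → A, IsIrregularLabeling G f

/-- The group irregularity strength: the smallest positive integer `s` such that every
Abelian group of order `s` admits an irregular labeling of `G`, and `⊤` if there is none.
Positivity matters because no group has order `0` (and `Nat.card A = 0` for infinite `A`). -/
noncomputable def groupIrregularityStrength (G : SimpleGraph V) : ℕ∞ :=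
  ⨅ (s : ℕ) (_ : 0 < s ∧ AdmitsAllOfOrder G s), (s : ℕ∞)

end GroupIrregularity

namespace GroupIrregularity

open Finset

/-! ### Tilings of finite sets by quadruples -/

/-! Distinct weights need at least n group elements, so the task is to realize a bijection from V to
a given group A of order n as a weighted degree function. The realizable functions form a subgroup
`weightedDegrees`. Labeling one edge puts the same value on both ends, so along a walk a weight can
be moved to a root r of its component with alternating sign. Hence four weights on vertices of one
sign are realizable if their sum is zero, and weights on two positive and two negative vertices if
the two pairs have equal sums.

Both criteria are met by four elements forming two pairs with a common sum s, 2s = 0. A splits into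
such quadruples except perhaps one, for which only the equality of the pair sums is kept
(`exists_quad_tiled_univ`). By the parity hypotheses each component splits into quadruples of one
sign or with two vertices of each sign; one of the latter can be reserved for the exceptional group
quadruple (`exists_quad_tiled_component`). Matching the quadruples (`Tiled.exists_injOn`) and adding
the realizable functions gives the labeling. -/

theorem exists_quad_of_four_le_card {α : Type*} {S : Finset α} (h : 4 ≤ S.card) :
    ∃ q : Fin 4 → α, Function.Injective q ∧ ∀ i, q i ∈ S := by
  obtain ⟨e⟩ : Nonempty (Fin 4 ↪ S) := by
    apply Function.Embedding.nonempty_of_card_le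
    simpa using h
  exact ⟨fun i => e i, Subtype.val_injective.comp e.injective, fun i => (e i).2⟩

theorem injective_quad {α : Type*} {a b c d : α} (hab : a ≠ b) (hac : a ≠ c) (had : a ≠ d) (hbc : b ≠ c)
    (hbd : b ≠ d) (hcd : c ≠ d) : Function.Injective ![a, b, c, d] := by
  intro i j h
  fin_cases i <;> fin_cases j <;> simp_all

theorem forall_quad {α : Type*} {a b c d : α} {P : α → Prop} (ha : P a) (hb : P b) (hc : P c) (hd : P d) :
    ∀ i, P (![a, b, c, d] i) := by
  intro i
  fin_cases i <;> simpa

/-- `S` is a disjoint union of ranges of injective quadruples satisfying `R`. -/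
inductive Tiled {α : Type*} [DecidableEq α] (R : (Fin 4 → α) → Prop) : Finset α → Prop
  | empty : Tiled R ∅
  | step {S : Finset α} {q : Fin 4 → α} : Tiled R S → Function.Injective q →
      (∀ i, q i ∉ S) → R q → Tiled R (S ∪ univ.image q)

section Tilings

variable {α : Type*} [DecidableEq α] {R : (Fin 4 → α) → Prop}

theorem card_union_image_quad {S : Finset α} {q : Fin 4 → α} (hq : Function.Injective q)
    (hS : ∀ i, q i ∉ S) : (S ∪ univ.image q).card = S.card + 4 := by
  rw [card_union_of_disjoint, card_image_of_injective _ hq]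
  · simp
  · rw [Finset.disjoint_left]
    intro a ha h
    obtain ⟨i, -, rfl⟩ := mem_image.1 h
    exact hS i ha

theorem Tiled.four_dvd_card {S : Finset α} (h : Tiled R S) : 4 ∣ S.card := by
  induction h with
  | empty => simp
  | step _ hq hS _ ih => rw [card_union_image_quad hq hS]; omega

theorem Tiled.union {S T : Finset α} (hS : Tiled R S) (hT : Tiled R T) (hd : Disjoint S T) :
    Tiled R (S ∪ T) := by
  induction hT with
  | empty => simpa using hS
  | @step T q _ hq hqT hR ih =>
    rw [← Finset.union_assoc]
    rw [disjoint_union_right] at hd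
    refine (ih hd.1).step hq (fun i => ?_) hR
    rw [mem_union, not_or]
    exact ⟨fun h => Finset.disjoint_left.1 hd.2 h (mem_image_of_mem _ (mem_univ i)), hqT i⟩

theorem Tiled.biUnion {ι : Type*} [DecidableEq ι] {s : Finset ι} {f : ι → Finset α}
    (h : ∀ i ∈ s, Tiled R (f i)) (hd : ∀ i j, i ≠ j → Disjoint (f i) (f j)) :
    Tiled R (s.biUnion f) := by
  induction s using Finset.induction_on with
  | empty => exact Tiled.empty
  | insert a s ha ih =>
    rw [biUnion_insert]
    refine (h a (mem_insert_self _ _)).union (ih fun i hi => h i (mem_insert_of_mem hi)) ?_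
    rw [disjoint_biUnion_right]
    intro j hj
    exact hd _ _ fun e => ha (e ▸ hj)

/-- Removing a quadruple from a set that is tiled afterwards. -/
theorem Tiled.of_sdiff {S : Finset α} {q : Fin 4 → α} (h : Tiled R (S \ univ.image q))
    (hq : Function.Injective q) (hS : ∀ i, q i ∈ S) (hR : R q) : Tiled R S := by
  have := h.step hq (fun i => by simp) hR
  rwa [sdiff_union_of_subset] at this
  intro a ha
  obtain ⟨i, -, rfl⟩ := mem_image.1 ha
  exact hS i

theorem card_sdiff_image_quad {S : Finset α} {q : Fin 4 → α} (hq : Function.Injective q)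
    (hS : ∀ i, q i ∈ S) : (S \ univ.image q).card + 4 = S.card := by
  have hsub : univ.image q ⊆ S := by
    intro a ha
    obtain ⟨i, -, rfl⟩ := mem_image.1 ha
    exact hS i
  have := card_sdiff_add_card_eq_card hsub
  rwa [card_image_of_injective _ hq, card_univ, Fintype.card_fin] at this

/-- A set of cardinality divisible by `4` is tiled if all its quadruples are admissible. -/
theorem tiled_of_forall_quad {S : Finset α} (hS : 4 ∣ S.card)
    (h : ∀ q : Fin 4 → α, (∀ i, q i ∈ S) → R q) : Tiled R S := by
  induction hn : S.card using Nat.strong_induction_on generalizing S with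
  | _ n ih =>
    rcases S.eq_empty_or_nonempty with rfl | hne
    · exact Tiled.empty
    · have := hne.card_pos
      obtain ⟨q, hq, hqS⟩ := exists_quad_of_four_le_card (S := S) (by omega)
      have hc := card_sdiff_image_quad hq hqS
      exact Tiled.of_sdiff (ih _ (by omega) (by omega)
        (fun q' h' => h q' fun i => (mem_sdiff.1 (h' i)).1) rfl) hq hqS (h q hqS)

/-- A quadruple with two elements in each of two disjoint sets. -/
theorem exists_quad_two_two {X Y : Finset α} (hd : Disjoint X Y) (hX : 2 ≤ X.card)
    (hY : 2 ≤ Y.card) :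
    ∃ q : Fin 4 → α, Function.Injective q ∧ q 0 ∈ X ∧ q 1 ∈ X ∧ q 2 ∈ Y ∧ q 3 ∈ Y ∧
      (X \ univ.image q).card + 2 = X.card ∧ (Y \ univ.image q).card + 2 = Y.card := by
  obtain ⟨a, ha, b, hb, hab⟩ := one_lt_card.1 (show 1 < X.card by omega)
  obtain ⟨c, hc, d, hd', hcd⟩ := one_lt_card.1 (show 1 < Y.card by omega)
  have hne : ∀ {x y}, x ∈ X → y ∈ Y → x ≠ y := fun hx hy e =>
    Finset.disjoint_left.1 hd hx (e ▸ hy)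
  have hmem : ∀ x, x ∈ univ.image ![a, b, c, d] ↔ x = a ∨ x = b ∨ x = c ∨ x = d := by
    intro x
    simp [Fin.exists_fin_succ, eq_comm]
  have hXe : X \ univ.image ![a, b, c, d] = (X.erase a).erase b := by
    ext x
    have h1 : x ∈ X → x ≠ c := fun hx => hne hx hc
    have h2 : x ∈ X → x ≠ d := fun hx => hne hx hd'
    rw [mem_sdiff, hmem, mem_erase, mem_erase]
    tauto
  have hYe : Y \ univ.image ![a, b, c, d] = (Y.erase c).erase d := by
    ext x
    have h1 : x ∈ Y → x ≠ a := fun hx => (hne ha hx).symm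
    have h2 : x ∈ Y → x ≠ b := fun hx => (hne hb hx).symm
    rw [mem_sdiff, hmem, mem_erase, mem_erase]
    tauto
  refine ⟨![a, b, c, d], injective_quad hab (hne ha hc) (hne ha hd') (hne hb hc) (hne hb hd') hcd,
    ha, hb, hc, hd', ?_, ?_⟩
  · have h1 := card_erase_add_one ha
    have h2 := card_erase_add_one (mem_erase.2 ⟨hab.symm, hb⟩)
    rw [hXe]
    omega
  · have h1 := card_erase_add_one hc
    have h2 := card_erase_add_one (mem_erase.2 ⟨hcd.symm, hd'⟩)
    rw [hYe]
    omega

/-- Two disjoint sets of even cardinalities summing to a multiple of `4` are tiled, if the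
quadruples inside one of the sets, and those with two elements in each, are admissible. -/
theorem tiled_union_of_even {X Y : Finset α} (hd : Disjoint X Y) (hX : Even X.card)
    (hY : Even Y.card) (h4 : 4 ∣ X.card + Y.card)
    (hRX : ∀ q : Fin 4 → α, (∀ i, q i ∈ X) → R q)
    (hRY : ∀ q : Fin 4 → α, (∀ i, q i ∈ Y) → R q)
    (hRXY : ∀ q : Fin 4 → α, q 0 ∈ X → q 1 ∈ X → q 2 ∈ Y → q 3 ∈ Y → R q) :
    Tiled R (X ∪ Y) := by
  by_cases h : 4 ∣ X.card
  · exact (tiled_of_forall_quad h hRX).union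
      (tiled_of_forall_quad ((Nat.dvd_add_right h).1 h4) hRY) hd
  -- Both cardinalities are now 2 mod 4; one quadruple with two elements in each set makes them
  -- multiples of 4.
  · rw [Nat.even_iff] at hX hY
    obtain ⟨q, hq, h0, h1, h2, h3, hXc, hYc⟩ :=
      exists_quad_two_two hd (by omega) (by omega)
    refine Tiled.of_sdiff ?_ hq (fun i => ?_) (hRXY q h0 h1 h2 h3)
    · rw [union_sdiff_distrib]
      exact (tiled_of_forall_quad (by omega) fun q' h' => hRX q' fun i =>
        (mem_sdiff.1 (h' i)).1).union (tiled_of_forall_quad (by omega) fun q' h' => hRY q' fun i =>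
        (mem_sdiff.1 (h' i)).1) (hd.mono sdiff_subset sdiff_subset)
    · rw [mem_union]
      fin_cases i <;> simp_all

/-- As `tiled_union_of_even`, singling out one quadruple with two elements in each set. -/
theorem exists_quad_tiled_sdiff {X Y : Finset α} (hd : Disjoint X Y) (hX : Even X.card)
    (hY : Even Y.card) (h4 : 4 ∣ X.card + Y.card) (hX0 : X.Nonempty) (hY0 : Y.Nonempty)
    (hRX : ∀ q : Fin 4 → α, (∀ i, q i ∈ X) → R q)
    (hRY : ∀ q : Fin 4 → α, (∀ i, q i ∈ Y) → R q)
    (hRXY : ∀ q : Fin 4 → α, q 0 ∈ X → q 1 ∈ X → q 2 ∈ Y → q 3 ∈ Y → R q) :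
    ∃ q : Fin 4 → α, Function.Injective q ∧ q 0 ∈ X ∧ q 1 ∈ X ∧ q 2 ∈ Y ∧ q 3 ∈ Y ∧
      Tiled R ((X ∪ Y) \ univ.image q) := by
  have := hX0.card_pos
  have := hY0.card_pos
  rw [Nat.even_iff] at hX hY
  obtain ⟨q, hq, h0, h1, h2, h3, hXc, hYc⟩ := exists_quad_two_two hd (by omega) (by omega)
  refine ⟨q, hq, h0, h1, h2, h3, ?_⟩
  rw [union_sdiff_distrib]
  exact tiled_union_of_even (hd.mono sdiff_subset sdiff_subset)
    (Nat.even_iff.2 (by omega)) (Nat.even_iff.2 (by omega)) (by omega)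
    (fun q' h' => hRX q' fun i => (mem_sdiff.1 (h' i)).1)
    (fun q' h' => hRY q' fun i => (mem_sdiff.1 (h' i)).1)
    (fun q' a b c d => hRXY q' (mem_sdiff.1 a).1 (mem_sdiff.1 b).1 (mem_sdiff.1 c).1
      (mem_sdiff.1 d).1)

end Tilings

/-! ### Tilings of finite Abelian groups -/

section Groups

variable {A : Type*} [AddCommGroup A]

/-- The first two entries have the same sum as the last two. -/
def EqualPairSums (q : Fin 4 → A) : Prop := q 0 + q 1 = q 2 + q 3

/-- Both pairs have the same sum, and this sum is annihilated by `2`. -/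
def NullPairSums (q : Fin 4 → A) : Prop := EqualPairSums q ∧ q 0 + q 1 + (q 0 + q 1) = 0

variable [DecidableEq A]

/-- A set closed under negation, without elements equal to their negative. -/
theorem tiled_of_neg_mem {T : Finset A} (h4 : 4 ∣ T.card) (hneg : ∀ x ∈ T, -x ∈ T)
    (hne : ∀ x ∈ T, -x ≠ x) : Tiled NullPairSums T := by
  induction hn : T.card using Nat.strong_induction_on generalizing T with
  | _ n ih =>
    rcases T.eq_empty_or_nonempty with rfl | ⟨x, hx⟩
    · exact Tiled.empty
    have hpos := card_pos.2 ⟨x, hx⟩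
    have h1 := card_erase_add_one hx
    have h2 := card_erase_add_one (mem_erase.2 ⟨hne x hx, hneg x hx⟩)
    obtain ⟨y, hy⟩ : ((T.erase x).erase (-x)).Nonempty := card_pos.1 (by omega)
    simp only [mem_erase] at hy
    obtain ⟨hyx', hyx, hyT⟩ := hy
    -- Both pairs have sum 0.
    have hq : Function.Injective ![x, -x, y, -y] :=
      injective_quad (hne x hx).symm hyx.symm (fun h => hyx' (by rw [h, neg_neg]))
        (Ne.symm hyx') (fun h => hyx (neg_injective h).symm) (hne y hyT).symm
    have hqT : ∀ i, ![x, -x, y, -y] i ∈ T := forall_quad hx (hneg x hx) hyT (hneg y hyT)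
    have hc := card_sdiff_image_quad hq hqT
    refine Tiled.of_sdiff (ih _ (by omega) (by omega) (fun z hz => ?_)
      (fun z hz => hne z (mem_sdiff.1 hz).1) rfl) hq hqT ?_
    · rw [mem_sdiff] at hz ⊢
      refine ⟨hneg z hz.1, fun h => hz.2 ?_⟩
      simp only [mem_image, mem_univ, true_and, Fin.exists_fin_succ] at h ⊢
      simp only [Matrix.cons_val_zero, Matrix.cons_val_succ, IsEmpty.exists_iff, or_false] at h ⊢
      rw [eq_neg_iff_add_eq_zero, neg_inj, eq_neg_iff_add_eq_zero, neg_inj] at h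
      rw [neg_eq_iff_add_eq_zero, neg_eq_iff_add_eq_zero]
      tauto
    · simp [NullPairSums, EqualPairSums]

/-- A set of elements annihilated by `2`, closed under translation by two distinct nonzero
such elements. -/
theorem tiled_of_add_mem {a b : A} (ha0 : a ≠ 0) (hb0 : b ≠ 0) (hab : a ≠ b) (ha : a + a = 0)
    (hb : b + b = 0) {T : Finset A} (hT : ∀ x ∈ T, x + x = 0) (hTa : ∀ x ∈ T, x + a ∈ T)
    (hTb : ∀ x ∈ T, x + b ∈ T) : Tiled NullPairSums T := by
  induction hn : T.card using Nat.strong_induction_on generalizing T with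
  | _ n ih =>
    rcases T.eq_empty_or_nonempty with rfl | ⟨x, hx⟩
    · exact Tiled.empty
    -- The quadruple is a coset of {0, a, b, a + b}; both pairs have sum a, because x and b are
    -- annihilated by 2.
    have hq : Function.Injective ![x, x + a, x + b, x + a + b] := by
      refine injective_quad (by simpa using ha0) (by simpa using hb0) (fun h => hab ?_)
        (by simpa using hab) (by simpa using hb0) (by simpa [add_right_comm] using ha0)
      have h' : a + b = 0 := by
        rw [add_assoc] at h
        simpa using h.symm
      exact add_right_cancel (h'.trans hb.symm)
    have hqT : ∀ i, ![x, x + a, x + b, x + a + b] i ∈ T :=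
      forall_quad hx (hTa x hx) (hTb x hx) (hTb _ (hTa x hx))
    have hc := card_sdiff_image_quad hq hqT
    have hsub : ∀ c z, (∀ i, ![x, x + a, x + b, x + a + b] i + c ∈
        univ.image ![x, x + a, x + b, x + a + b]) → c + c = 0 → (∀ x ∈ T, x + c ∈ T) →
        z ∈ T \ univ.image ![x, x + a, x + b, x + a + b] →
        z + c ∈ T \ univ.image ![x, x + a, x + b, x + a + b] := by
      intro c z hcq hcc hTc hz
      rw [mem_sdiff] at hz ⊢
      refine ⟨hTc z hz.1, fun h => hz.2 ?_⟩
      obtain ⟨i, -, hi⟩ := mem_image.1 h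
      have := hcq i
      have hzc : z + c + c = z := by rw [add_assoc, hcc, add_zero]
      rwa [hi, hzc] at this
    have hmem : ∀ z, z ∈ univ.image ![x, x + a, x + b, x + a + b] ↔
        z = x ∨ z = x + a ∨ z = x + b ∨ z = x + a + b := by
      intro z
      simp [Fin.exists_fin_succ, eq_comm]
    have hba : x + b + a = x + a + b := add_right_comm _ _ _
    have haa : x + a + a = x := by rw [add_assoc, ha, add_zero]
    have hbb : x + b + b = x := by rw [add_assoc, hb, add_zero]
    have haba : x + a + b + a = x + b := by rw [add_right_comm, haa]
    have habb : x + a + b + b = x + a := by rw [add_assoc, hb, add_zero]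
    refine Tiled.of_sdiff (ih _ (by omega) (fun z hz => hT z (mem_sdiff.1 hz).1)
      (fun z hz => hsub a z (fun i => ?_) ha hTa hz) (fun z hz => hsub b z (fun i => ?_) hb hTb hz)
      rfl) hq hqT ?_
    · rw [hmem]
      exact forall_quad (P := fun y => y + a = x ∨ y + a = x + a ∨ y + a = x + b ∨
        y + a = x + a + b) (by simp) (by simp [haa]) (by simp [hba]) (by simp [haba]) i
    · rw [hmem]
      exact forall_quad (P := fun y => y + b = x ∨ y + b = x + a ∨ y + b = x + b ∨
        y + b = x + a + b) (by simp) (by simp) (by simp [hbb]) (by simp [habb]) i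
    · have hxx := hT x hx
      have h1 : x + (x + a) = a := by rw [← add_assoc, hxx, zero_add]
      have h2 : x + b + (x + a + b) = x + x + a + (b + b) := by abel
      simp [NullPairSums, EqualPairSums, h1, h2, hxx, ha, hb]

/-- A finite Abelian group whose order is a multiple of `4` is tiled by quadruples consisting of
two pairs with a common sum, which is annihilated by `2` for all quadruples except one. -/
theorem exists_quad_tiled_univ [Fintype A] (h4 : 4 ∣ Fintype.card A) :
    ∃ q : Fin 4 → A, Function.Injective q ∧ EqualPairSums q ∧
      Tiled NullPairSums (univ \ univ.image q) := by
  classical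
  set I : Finset A := univ.filter fun x => x + x = 0 with hI
  have memI : ∀ x, x ∈ I ↔ x + x = 0 := fun x => by simp [hI]
  obtain ⟨a, ha⟩ : ∃ a : A, addOrderOf a = 2 :=
    exists_prime_addOrderOf_dvd_card 2 ((by norm_num : 2 ∣ 4).trans h4)
  have ha0 : a ≠ 0 := by
    rintro rfl
    simp at ha
  have haa : a + a = 0 := by rw [← two_nsmul, ← ha, addOrderOf_nsmul_eq_zero]
  -- With a second involution b, translation by a and b tiles `I` and negation tiles its complement,
  -- so no exceptional quadruple is needed. If a is the only involution, A sums to a ≠ 0 while null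
  -- quadruples sum to 0, so one is unavoidable.
  by_cases hI2 : ∃ b, b + b = 0 ∧ b ≠ 0 ∧ a ≠ b
  · obtain ⟨b, hbb, hb0, hab⟩ := hI2
    have hIt : Tiled NullPairSums I := by
      refine tiled_of_add_mem ha0 hb0 hab haa hbb (fun x hx => (memI x).1 hx) (fun x hx => ?_)
        (fun x hx => ?_) <;> rw [memI] at hx ⊢
      · rw [add_add_add_comm, hx, haa, add_zero]
      · rw [add_add_add_comm, hx, hbb, add_zero]
    have hNt : Tiled NullPairSums (univ \ I) := by
      refine tiled_of_neg_mem ?_ (fun x hx => ?_) fun x hx => ?_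
      · have h := card_sdiff_add_card_eq_card (subset_univ I)
        rw [card_univ] at h
        exact (Nat.dvd_add_left hIt.four_dvd_card).1 (h ▸ h4)
      · simp only [mem_sdiff, mem_univ, true_and, memI] at hx ⊢
        rwa [← neg_add, neg_eq_zero]
      · simp only [mem_sdiff, mem_univ, true_and, memI] at hx
        rwa [Ne, neg_eq_iff_add_eq_zero]
    have hu := hNt.union hIt sdiff_disjoint
    rw [sdiff_union_of_subset (subset_univ I)] at hu
    -- `cases` needs a variable as the index. The last tile serves as the distinguished quadruple.
    generalize hU : (univ : Finset A) = U at hu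
    cases hu with
    | empty => exact absurd (hU ▸ mem_univ (0 : A)) (notMem_empty _)
    | @step S q hS hq hqS hR =>
      refine ⟨q, hq, hR.1, ?_⟩
      rw [union_sdiff_cancel_right]
      · exact hS
      · rw [disjoint_comm, Finset.disjoint_left]
        intro z hz
        obtain ⟨i, -, rfl⟩ := mem_image.1 hz
        exact hqS i
  · have hI2' : ∀ b, b + b = 0 → b = 0 ∨ a = b := by
      intro b hb
      by_contra! h
      exact hI2 ⟨b, hb, h.1, h.2⟩
    -- Doubling has kernel {0, a}, so its range has even order and contains an involution, which can
    -- only be a.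
    obtain ⟨x, hx⟩ : ∃ x, x + x = a := by
      let D : A →+ A := nsmulAddMonoidHom 2
      have hk : Nat.card D.ker = 2 := by
        have : (D.ker : Set A) = {0, a} := by
          ext z
          simp only [SetLike.mem_coe, AddMonoidHom.mem_ker, D, nsmulAddMonoidHom_apply, two_nsmul,
            Set.mem_insert_iff, Set.mem_singleton_iff]
          constructor
          · intro h
            exact (hI2' z h).imp id Eq.symm
          · rintro (rfl | rfl)
            · simp
            · exact haa
        rw [← SetLike.coe_sort_coe, this, Nat.card_coe_set_eq, Set.ncard_pair ha0.symm]
      have hr : 2 ∣ Nat.card D.range := by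
        have h := AddSubgroup.card_mul_index D.ker
        rw [AddSubgroup.index_ker, hk, Nat.card_eq_fintype_card (α := A)] at h
        omega
      obtain ⟨⟨_, x, rfl⟩, hy⟩ := exists_prime_addOrderOf_dvd_card' (G := D.range) 2 hr
      refine ⟨x, ?_⟩
      rw [← AddSubgroup.addOrderOf_coe] at hy
      have hD : D x = x + x := two_nsmul x
      simp only [hD] at hy
      refine ((hI2' (x + x) ?_).resolve_left ?_).symm
      · rw [← two_nsmul (x + x), ← hy, addOrderOf_nsmul_eq_zero]
      · intro h
        simp [h] at hy
    have hxn : -x ≠ x := by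
      rw [Ne, neg_eq_iff_add_eq_zero, hx]
      exact ha0
    have hx0 : x ≠ 0 := by
      rintro rfl
      exact ha0 (by simpa using hx.symm)
    have hxa : x ≠ a := by
      rintro rfl
      exact ha0 (by simpa using hx)
    have hna : -a = a := neg_eq_of_add_eq_zero_left haa
    -- Since 2x = a, the pair sums 0 + x and a - x agree; removing these four elements leaves a set
    -- closed under negation and free of involutions.
    have hq : Function.Injective ![0, x, a, -x] :=
      injective_quad hx0.symm ha0.symm (by simpa using hx0) hxa hxn.symm
        (fun h => hxa (by rw [← neg_neg x, ← h, hna]))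
    refine ⟨![0, x, a, -x], hq, ?_, tiled_of_neg_mem ?_ (fun z hz => ?_) fun z hz => ?_⟩
    · simp [EqualPairSums, ← hx]
    · have h := card_sdiff_image_quad hq (fun i => mem_univ _)
      rw [card_univ] at h
      omega
    all_goals
      have hmem : ∀ z, z ∈ univ.image ![0, x, a, -x] ↔ z = 0 ∨ z = x ∨ z = a ∨ z = -x := by
        intro z
        simp [Fin.exists_fin_succ, eq_comm]
      simp only [mem_sdiff, mem_univ, true_and, hmem] at hz ⊢
    · rw [neg_eq_zero, neg_eq_iff_eq_neg, neg_eq_iff_eq_neg, hna, neg_inj]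
      tauto
    · intro h
      rw [neg_eq_iff_add_eq_zero] at h
      exact hz ((hI2' z h).imp id fun h => Or.inr (Or.inl h.symm))

end Groups

/-! ### Matching tilings -/

section Matching

variable {V A : Type*} [DecidableEq V] [AddCommGroup A]

/-- The function that maps `q i` to `α i` and vanishes elsewhere. -/
def quadFun (q : Fin 4 → V) (α : Fin 4 → A) : V → A := ∑ i, Pi.single (q i) (α i)

theorem quadFun_apply {q : Fin 4 → V} (hq : Function.Injective q) (α : Fin 4 → A) (i : Fin 4) :
    quadFun q α (q i) = α i := by
  rw [quadFun, Finset.sum_apply, Finset.sum_eq_single i]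
  · simp
  · intro j _ hj
    exact Pi.single_eq_of_ne (hq.ne hj.symm) _
  · simp

theorem quadFun_apply_of_ne {q : Fin 4 → V} (α : Fin 4 → A) {v : V} (hv : ∀ i, q i ≠ v) :
    quadFun q α v = 0 := by
  rw [quadFun, Finset.sum_apply]
  exact Finset.sum_eq_zero fun i _ => Pi.single_eq_of_ne (hv i).symm _

/-- Extending an injective function by a quadruple. -/
theorem injOn_add_quadFun [DecidableEq A] {S : Finset V} {S' : Finset A} {w : V → A} (hw : Set.InjOn w S)
    (hwS : ∀ v ∈ S, w v ∈ S') (hw0 : ∀ v ∉ S, w v = 0) {q : Fin 4 → V} {α : Fin 4 → A}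
    (hq : Function.Injective q) (hα : Function.Injective α) (hqS : ∀ i, q i ∉ S)
    (hαS : ∀ i, α i ∉ S') :
    Set.InjOn (w + quadFun q α) ↑(S ∪ univ.image q) ∧
      (∀ v ∈ S ∪ univ.image q, (w + quadFun q α) v ∈ S' ∪ univ.image α) ∧
      ∀ v ∉ S ∪ univ.image q, (w + quadFun q α) v = 0 := by
  have e1 : ∀ v ∈ S, (w + quadFun q α) v = w v := fun v hv => by
    rw [Pi.add_apply, quadFun_apply_of_ne _ fun i h => hqS i (by rwa [h]), add_zero]
  have e2 : ∀ i, (w + quadFun q α) (q i) = α i := fun i => by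
    rw [Pi.add_apply, quadFun_apply hq, hw0 _ (hqS i), zero_add]
  have hmem : ∀ v, v ∈ S ∪ univ.image q ↔ v ∈ S ∨ ∃ i, q i = v := by simp
  refine ⟨?_, ?_, ?_⟩
  · intro u hu v hv h
    rw [mem_coe, hmem] at hu hv
    rcases hu with hu | ⟨i, rfl⟩ <;> rcases hv with hv | ⟨j, rfl⟩
    · rw [e1 u hu, e1 v hv] at h
      exact hw hu hv h
    · rw [e1 u hu, e2] at h
      exact absurd (h ▸ hwS u hu) (hαS j)
    · rw [e1 v hv, e2] at h
      exact absurd (h ▸ hwS v hv) (hαS i)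
    · rw [e2, e2] at h
      rw [hα h]
  · intro v hv
    rw [hmem] at hv
    rcases hv with hv | ⟨i, rfl⟩
    · rw [e1 v hv]
      exact mem_union_left _ (hwS v hv)
    · rw [e2]
      exact mem_union_right _ (mem_image_of_mem _ (mem_univ i))
  · intro v hv
    rw [hmem, not_or, not_exists] at hv
    rw [Pi.add_apply, hw0 v hv.1, quadFun_apply_of_ne _ hv.2, add_zero]

/-- Quadruples of two tilings are matched in order. -/
theorem Tiled.exists_injOn [DecidableEq A] {W : AddSubgroup (V → A)} {R : (Fin 4 → A) → Prop} {S : Finset V}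
    {S' : Finset A} (hS : Tiled (fun q => ∀ α, R α → quadFun q α ∈ W) S) (hS' : Tiled R S')
    (hc : S.card = S'.card) :
    ∃ w ∈ W, Set.InjOn w S ∧ (∀ v ∈ S, w v ∈ S') ∧ ∀ v ∉ S, w v = 0 := by
  induction hS generalizing S' with
  | empty => exact ⟨0, W.zero_mem, by simp, by simp, by simp⟩
  | @step S q _ hq hqS hR ih =>
    rw [card_union_image_quad hq hqS] at hc
    -- Each vertex quadruple accepts every `R`-quadruple, so the last tiles of the two sets can be
    -- matched.
    cases hS' with
    | empty => simp at hc
    | @step S' α hS' hα hαS hRα =>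
      rw [card_union_image_quad hα hαS] at hc
      obtain ⟨w, hwW, hw, hwS, hw0⟩ := ih hS' (by omega)
      exact ⟨w + quadFun q α, W.add_mem hwW (hR α hRα),
        injOn_add_quadFun hw hwS hw0 hq hα hqS hαS⟩

end Matching

/-! ### Functions that are weighted degrees -/

section WeightedDegrees

variable {V : Type*} [Fintype V] (G : SimpleGraph V) (A : Type*) [AddCommGroup A]

/-- The functions on the vertices that are the weighted degrees of some labeling. -/
noncomputable def weightedDegrees : AddSubgroup (V → A) :=
  AddMonoidHom.range
    { toFun := fun f : G.edgeSet → A => weightedDegree G f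
      map_zero' := by
        ext v
        simp [weightedDegree]
      map_add' := fun f g => by
        ext v
        simp [weightedDegree, Finset.sum_add_distrib] }

variable {G A}

theorem mem_weightedDegrees {w : V → A} :
    w ∈ weightedDegrees G A ↔ ∃ f : G.edgeSet → A, weightedDegree G f = w :=
  Iff.rfl

variable [DecidableEq V]

/-- The labeling is a on the edge uv and 0 elsewhere. -/
theorem single_add_single_mem_weightedDegrees {u v : V} (h : G.Adj u v) (a : A) :
    (Pi.single u a + Pi.single v a : V → A) ∈ weightedDegrees G A := by
  classical
  refine ⟨Pi.single ⟨s(u, v), h⟩ a, ?_⟩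
  ext x
  have hval : ∀ y : G.neighborSet x, (Pi.single ⟨s(u, v), h⟩ a : G.edgeSet → A)
      ⟨s(x, (y : V)), y.2⟩ = if s(x, (y : V)) = s(u, v) then a else 0 := by
    intro y
    by_cases e : s(x, (y : V)) = s(u, v)
    · rw [if_pos e, Pi.single_apply, if_pos (Subtype.ext e)]
    · rw [if_neg e, Pi.single_apply, if_neg fun h => e (congrArg Subtype.val h)]
  change weightedDegree G _ x = _
  rw [weightedDegree, Pi.add_apply]
  simp only [hval]
  by_cases hxu : x = u
  · subst hxu
    rw [Pi.single_eq_same, Pi.single_eq_of_ne h.ne, add_zero,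
      Finset.sum_eq_single (⟨v, h⟩ : G.neighborSet x)]
    · simp
    · intro y _ hy
      rw [if_neg]
      intro e
      exact hy (Subtype.ext (Sym2.congr_right.1 e))
    · simp
  · by_cases hxv : x = v
    · subst hxv
      rw [Pi.single_eq_same, Pi.single_eq_of_ne hxu, zero_add,
        Finset.sum_eq_single (⟨u, h.symm⟩ : G.neighborSet x)]
      · simp [Sym2.eq_swap]
      · intro y _ hy
        rw [if_neg]
        intro e
        exact hy (Subtype.ext (Sym2.congr_right.1 (e.trans Sym2.eq_swap)))
      · simp
    · rw [Pi.single_eq_of_ne hxu, Pi.single_eq_of_ne hxv, add_zero]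
      refine Finset.sum_eq_zero fun y _ => if_neg ?_
      intro e
      rcases Sym2.eq_iff.1 e with e | e
      · exact hxu e.1
      · exact hxv e.1


/-! ### Signs of vertices relative to a root -/

variable (G A) in
/-- A weight at `v` can be replaced with the same weight at `r`. -/
def IsPositive (r v : V) : Prop :=
  ∀ a : A, (Pi.single v a - Pi.single r a : V → A) ∈ weightedDegrees G A

variable (G A) in
/-- A weight at `v` can be replaced with the opposite weight at `r`. -/
def IsNegative (r v : V) : Prop :=
  ∀ a : A, (Pi.single v a + Pi.single r a : V → A) ∈ weightedDegrees G A

theorem isPositive_refl (r : V) : IsPositive G A r r := fun a => by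
  rw [sub_self]
  exact zero_mem _

theorem IsPositive.isNegative {r u v : V} (h : IsPositive G A r u) (huv : G.Adj u v) :
    IsNegative G A r v := fun a => by
  have := sub_mem (single_add_single_mem_weightedDegrees huv a) (h a)
  rwa [show (Pi.single u a + Pi.single v a - (Pi.single u a - Pi.single r a) : V → A) =
    Pi.single v a + Pi.single r a by abel] at this

theorem IsNegative.isPositive {r u v : V} (h : IsNegative G A r u) (huv : G.Adj u v) :
    IsPositive G A r v := fun a => by
  have := sub_mem (single_add_single_mem_weightedDegrees huv a) (h a)
  rwa [show (Pi.single u a + Pi.single v a - (Pi.single u a + Pi.single r a) : V → A) =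
    Pi.single v a - Pi.single r a by abel] at this

/-- The sign alternates along a walk from r. -/
theorem isPositive_or_isNegative {r v : V} (h : G.Reachable r v) :
    IsPositive G A r v ∨ IsNegative G A r v := by
  rw [SimpleGraph.reachable_iff_reflTransGen] at h
  induction h with
  | refl => exact Or.inl (isPositive_refl r)
  | tail _ h ih => exact ih.symm.imp (fun k => k.isPositive h) fun k => k.isNegative h

theorem isPositive_and_isNegative {r u v : V} (h : G.Reachable u v)
    (hu : IsPositive G A r u ∧ IsNegative G A r u) :
    IsPositive G A r v ∧ IsNegative G A r v := by
  rw [SimpleGraph.reachable_iff_reflTransGen] at h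
  induction h with
  | refl => exact hu
  | tail _ h ih => exact ⟨ih.2.isPositive h, ih.1.isNegative h⟩

/-- Moving all four weights to r leaves their sum there, which vanishes. -/
theorem quadFun_mem_of_isPositive {r : V} {q : Fin 4 → V} {α : Fin 4 → A}
    (hq : ∀ i, IsPositive G A r (q i)) (hα : ∑ i, α i = 0) :
    quadFun q α ∈ weightedDegrees G A := by
  have h := sum_mem fun i (_ : i ∈ univ) => hq i (α i)
  have h0 : (∑ i, Pi.single r (α i) : V → A) = 0 := by
    rw [← Pi.single_zero r, ← hα]
    exact (map_sum (AddMonoidHom.single (fun _ : V => A) r) α univ).symm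
  rwa [Finset.sum_sub_distrib, h0, sub_zero] at h

theorem quadFun_mem_of_isNegative {r : V} {q : Fin 4 → V} {α : Fin 4 → A}
    (hq : ∀ i, IsNegative G A r (q i)) (hα : ∑ i, α i = 0) :
    quadFun q α ∈ weightedDegrees G A := by
  have h := sum_mem fun i (_ : i ∈ univ) => hq i (α i)
  have h0 : (∑ i, Pi.single r (α i) : V → A) = 0 := by
    rw [← Pi.single_zero r, ← hα]
    exact (map_sum (AddMonoidHom.single (fun _ : V => A) r) α univ).symm
  rwa [Finset.sum_add_distrib, h0, add_zero] at h

/-- The weights moved to r from the positive pair cancel those from the negative pair. -/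
theorem quadFun_mem_of_equalPairSums {r : V} {q : Fin 4 → V} {α : Fin 4 → A}
    (h0 : IsPositive G A r (q 0)) (h1 : IsPositive G A r (q 1)) (h2 : IsNegative G A r (q 2))
    (h3 : IsNegative G A r (q 3)) (hα : EqualPairSums α) :
    quadFun q α ∈ weightedDegrees G A := by
  have h := add_mem (add_mem (h0 (α 0)) (h1 (α 1))) (add_mem (h2 (α 2)) (h3 (α 3)))
  have hr : (Pi.single r (α 0) + Pi.single r (α 1) : V → A) =
      Pi.single r (α 2) + Pi.single r (α 3) := by
    rw [← Pi.single_add, ← Pi.single_add, hα]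
  have he : quadFun q α = (Pi.single (q 0) (α 0) - Pi.single r (α 0) +
      (Pi.single (q 1) (α 1) - Pi.single r (α 1)) + (Pi.single (q 2) (α 2) + Pi.single r (α 2) +
      (Pi.single (q 3) (α 3) + Pi.single r (α 3))) : V → A) +
      ((Pi.single r (α 0) + Pi.single r (α 1)) - (Pi.single r (α 2) + Pi.single r (α 3))) := by
    rw [quadFun, Fin.sum_univ_four]
    abel
  rw [he, hr, sub_self, add_zero]
  exact h

theorem NullPairSums.sum_eq_zero {α : Fin 4 → A} (h : NullPairSums α) : ∑ i, α i = 0 := by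
  rw [Fin.sum_univ_four, add_assoc, ← h.1]
  exact h.2

variable (G A) in
/-- Placing the entries of an admissible quadruple of `A` at the vertices of `q` yields the
weighted degrees of some labeling. -/
def AbsorbsNull (q : Fin 4 → V) : Prop :=
  ∀ α : Fin 4 → A, NullPairSums α → quadFun q α ∈ weightedDegrees G A

/-! ### Tiling a component -/

open Classical in
/-- The two sign classes of a component without vertices of both signs are its colour classes. -/
theorem even_card_sign_classes {c : G.ConnectedComponent} {r : V} (hr : r ∈ c.supp)
    (hbip : ∀ (κ : c.toSimpleGraph.Coloring Bool) (b : Bool), Even (κ.colorClass b).ncard)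
    (hno : ∀ v ∈ c.supp, ¬ (IsPositive G A r v ∧ IsNegative G A r v)) :
    Even (c.supp.toFinset.filter (IsPositive G A r)).card ∧
      Even (c.supp.toFinset.filter (IsNegative G A r)).card := by
  have hor : ∀ v ∈ c.supp, IsPositive G A r v ∨ IsNegative G A r v := fun v hv =>
    isPositive_or_isNegative (SimpleGraph.ConnectedComponent.exact (hr.trans hv.symm))
  -- An edge joining vertices of equal sign would give one of its ends both signs, which `hno`
  -- excludes; so the sign is a proper 2-coloring.
  let κ : c.toSimpleGraph.Coloring Bool :=
    SimpleGraph.Coloring.mk (fun v => decide (IsPositive G A r v.1)) (by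
      rintro ⟨u, hu⟩ ⟨v, hv⟩ huv he
      have huv' : G.Adj u v := huv
      have he' : IsPositive G A r u ↔ IsPositive G A r v := decide_eq_decide.1 he
      rcases hor u hu with h | h
      · exact hno v hv ⟨he'.1 h, h.isNegative huv'⟩
      · exact hno u hu ⟨he'.2 (h.isPositive huv'), h⟩)
  have hκ : ∀ b, Even (c.supp.toFinset.filter fun v => decide (IsPositive G A r v) = b).card := by
    intro b
    have h := hbip κ b
    rw [← Set.ncard_image_of_injective _ Subtype.val_injective] at h
    rw [← Set.ncard_coe_finset]
    convert h using 2
    ext v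
    simp only [coe_filter, Set.mem_toFinset, Set.mem_ofPred_eq, Set.mem_image]
    constructor
    · rintro ⟨hv, hb⟩
      exact ⟨⟨v, hv⟩, hb, rfl⟩
    · rintro ⟨⟨v, hv⟩, hb, rfl⟩
      exact ⟨hv, hb⟩
  refine ⟨by simpa using hκ true, ?_⟩
  convert hκ false using 2
  refine Finset.filter_congr fun v hv => ?_
  rw [Set.mem_toFinset] at hv
  have := hor v hv
  have := hno v hv
  rw [decide_eq_false_iff_not]
  tauto

open Classical in
/-- A component satisfying the parity conditions is tiled, with one quadruple that absorbs all
quadruples with equal pair sums. -/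
theorem exists_quad_tiled_component {c : G.ConnectedComponent} (hfour : 4 ∣ c.supp.ncard)
    (hbip : ∀ (κ : c.toSimpleGraph.Coloring Bool) (b : Bool), Even (κ.colorClass b).ncard) :
    ∃ q : Fin 4 → V, Function.Injective q ∧ (∀ i, q i ∈ c.supp.toFinset) ∧
      (∀ α : Fin 4 → A, EqualPairSums α → quadFun q α ∈ weightedDegrees G A) ∧
      Tiled (AbsorbsNull G A) (c.supp.toFinset \ univ.image q) := by
  rw [Set.ncard_eq_toFinset_card'] at hfour
  obtain ⟨r, hr⟩ := c.nonempty_supp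
  have hpos : 0 < c.supp.toFinset.card := card_pos.2 ⟨r, Set.mem_toFinset.2 hr⟩
  have hreach : ∀ u ∈ c.supp, ∀ v ∈ c.supp, G.Reachable u v := fun u hu v hv =>
    SimpleGraph.ConnectedComponent.exact (hu.trans hv.symm)
  -- One vertex with both signs passes them to the whole component, so every quadruple is
  -- admissible. This can happen in a bipartite component too, for instance if A has exponent 2.
  by_cases hboth : ∃ u ∈ c.supp, IsPositive G A r u ∧ IsNegative G A r u
  · obtain ⟨u, hu, hur⟩ := hboth
    have hall : ∀ v ∈ c.supp.toFinset, IsPositive G A r v ∧ IsNegative G A r v := fun v hv =>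
      isPositive_and_isNegative (hreach u hu v (Set.mem_toFinset.1 hv)) hur
    have hR : ∀ q : Fin 4 → V, (∀ i, q i ∈ c.supp.toFinset) → ∀ α : Fin 4 → A,
        EqualPairSums α → quadFun q α ∈ weightedDegrees G A := fun q hq α hα =>
      quadFun_mem_of_equalPairSums (hall _ (hq 0)).1 (hall _ (hq 1)).1 (hall _ (hq 2)).2
        (hall _ (hq 3)).2 hα
    obtain ⟨q, hq, hqS⟩ := exists_quad_of_four_le_card (S := c.supp.toFinset) (by omega)
    have hc := card_sdiff_image_quad hq hqS
    exact ⟨q, hq, hqS, hR q hqS, tiled_of_forall_quad (by omega) fun q' hq' α hα =>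
      hR q' (fun i => (mem_sdiff.1 (hq' i)).1) α hα.1⟩
  · have hno : ∀ v ∈ c.supp, ¬ (IsPositive G A r v ∧ IsNegative G A r v) := fun v hv h =>
      hboth ⟨v, hv, h⟩
    obtain ⟨hX, hY⟩ := even_card_sign_classes hr hbip hno
    set X := c.supp.toFinset.filter (IsPositive G A r) with hXdef
    set Y := c.supp.toFinset.filter (IsNegative G A r) with hYdef
    have hd : Disjoint X Y := by
      rw [Finset.disjoint_left]
      intro v hvX hvY
      rw [hXdef, mem_filter, Set.mem_toFinset] at hvX
      exact hno v hvX.1 ⟨hvX.2, (mem_filter.1 hvY).2⟩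
    have hXY : X ∪ Y = c.supp.toFinset := by
      rw [hXdef, hYdef, ← filter_or, filter_true_of_mem]
      intro v hv
      exact isPositive_or_isNegative (hreach r hr v (Set.mem_toFinset.1 hv))
    have hrX : r ∈ X := mem_filter.2 ⟨Set.mem_toFinset.2 hr, isPositive_refl r⟩
    -- The component has more than one vertex, so r has a neighbour, which is negative.
    have hY0 : Y.Nonempty := by
      obtain ⟨v, hv, hvr⟩ := exists_mem_ne (show 1 < c.supp.toFinset.card by omega) r
      rw [Set.mem_toFinset] at hv
      obtain ⟨w, hw, -⟩ := (Relation.ReflTransGen.cases_head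
        ((SimpleGraph.reachable_iff_reflTransGen r v).1 (hreach r hr v hv))).resolve_left hvr.symm
      refine ⟨w, mem_filter.2 ⟨?_, (isPositive_refl r).isNegative hw⟩⟩
      rw [Set.mem_toFinset]
      exact (SimpleGraph.ConnectedComponent.sound hw.symm.reachable).trans hr
    have hXp : ∀ v ∈ X, IsPositive G A r v := fun v hv => (mem_filter.1 hv).2
    have hYn : ∀ v ∈ Y, IsNegative G A r v := fun v hv => (mem_filter.1 hv).2
    obtain ⟨q, hq, h0, h1, h2, h3, ht⟩ := exists_quad_tiled_sdiff (R := AbsorbsNull G A) hd hX hY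
      (by rwa [← card_union_of_disjoint hd, hXY]) ⟨r, hrX⟩ hY0
      (fun q hq α hα => quadFun_mem_of_isPositive (fun i => hXp _ (hq i)) hα.sum_eq_zero)
      (fun q hq α hα => quadFun_mem_of_isNegative (fun i => hYn _ (hq i)) hα.sum_eq_zero)
      (fun q h0 h1 h2 h3 α hα => quadFun_mem_of_equalPairSums (hXp _ h0) (hXp _ h1) (hYn _ h2)
        (hYn _ h3) hα.1)
    rw [hXY] at ht
    refine ⟨q, hq, fun i => ?_, fun α hα => quadFun_mem_of_equalPairSums (hXp _ h0) (hXp _ h1)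
      (hYn _ h2) (hYn _ h3) hα, ht⟩
    rw [← hXY, mem_union]
    fin_cases i <;> simp_all

end WeightedDegrees

/-! ### Upper and lower bounds -/

/-- The group order equal to the number of vertices suffices. -/
theorem admitsAllOfOrder_card {V : Type*} [Fintype V] [Nonempty V] (G : SimpleGraph V)
    (hfour : ∀ c : G.ConnectedComponent, 4 ∣ c.supp.ncard)
    (hbip : ∀ (c : G.ConnectedComponent) (κ : c.toSimpleGraph.Coloring Bool) (b : Bool),
      Even (κ.colorClass b).ncard) :
    AdmitsAllOfOrder G (Fintype.card V) := by
  classical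
  intro A _ hA
  have : Finite A := Nat.finite_of_card_ne_zero (hA ▸ Fintype.card_ne_zero)
  have := Fintype.ofFinite A
  rw [Nat.card_eq_fintype_card] at hA
  have hcomp := fun c : G.ConnectedComponent =>
    exists_quad_tiled_component (A := A) (hfour c) (hbip c)
  have htile : ∀ c : G.ConnectedComponent, Tiled (AbsorbsNull G A) c.supp.toFinset := by
    intro c
    obtain ⟨q, hq, hqc, hqR, ht⟩ := hcomp c
    exact Tiled.of_sdiff ht hq hqc fun α hα => hqR α hα.1
  have hdisj : ∀ c d : G.ConnectedComponent, c ≠ d →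
      Disjoint c.supp.toFinset d.supp.toFinset := by
    intro c d hcd
    rw [Finset.disjoint_left]
    intro v hc hd
    rw [Set.mem_toFinset] at hc hd
    exact hcd (hc.symm.trans hd)
  -- Any component can host the exceptional quadruple; all the others are tiled completely.
  let c : G.ConnectedComponent := G.connectedComponentMk (Classical.arbitrary V)
  obtain ⟨q, hq, hqc, hqR, ht⟩ := hcomp c
  have hV : Tiled (AbsorbsNull G A) (univ \ univ.image q) := by
    have hrest : Tiled (AbsorbsNull G A)
        ((univ.erase c).biUnion fun d : G.ConnectedComponent => d.supp.toFinset) :=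
      Tiled.biUnion (fun d _ => htile d) hdisj
    have hd : Disjoint c.supp.toFinset
        ((univ.erase c).biUnion fun d : G.ConnectedComponent => d.supp.toFinset) := by
      rw [disjoint_biUnion_right]
      exact fun d hd => hdisj c d (mem_erase.1 hd).1.symm
    convert ht.union hrest (hd.mono_left sdiff_subset) using 1
    ext v
    have hv : v ∈ univ.image q → v ∈ c.supp.toFinset := by
      intro h
      obtain ⟨i, -, rfl⟩ := mem_image.1 h
      exact hqc i
    have hv' : v ∈ (univ.erase c).biUnion (fun d : G.ConnectedComponent => d.supp.toFinset) ↔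
        v ∉ c.supp.toFinset := by
      simp only [mem_biUnion, mem_erase, mem_univ, and_true, Set.mem_toFinset]
      constructor
      · rintro ⟨d, hdc, hd⟩ hc
        exact hdc (hd.symm.trans hc)
      · exact fun h => ⟨G.connectedComponentMk v, h, rfl⟩
    rw [mem_union, hv', mem_sdiff, mem_sdiff]
    simp only [mem_univ, true_and]
    tauto
  have h4 : 4 ∣ Fintype.card A := by
    have h := card_sdiff_image_quad hq fun i => mem_univ (q i)
    have := hV.four_dvd_card
    rw [card_univ] at h
    omega
  obtain ⟨α, hα, hαe, hAt⟩ := exists_quad_tiled_univ h4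
  have hcq := card_sdiff_image_quad hq fun i => mem_univ (q i)
  have hcα := card_sdiff_image_quad hα fun i => mem_univ (α i)
  rw [card_univ] at hcq hcα
  obtain ⟨w, hwW, hw, hwS, hw0⟩ := Tiled.exists_injOn hV hAt (by omega)
  have hinj := (injOn_add_quadFun hw hwS hw0 hq hα (by simp) (by simp)).1
  obtain ⟨f, hf⟩ := mem_weightedDegrees.1 (add_mem hwW (hqR α hαe))
  refine ⟨f, ?_⟩
  rw [IsIrregularLabeling, hf]
  rw [sdiff_union_of_subset (subset_univ _), coe_univ] at hinj
  exact Set.injOn_univ.1 hinj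

/-- An irregular labeling requires at least as many group elements as vertices. -/
theorem AdmitsAllOfOrder.card_le {V : Type*} [Fintype V] {G : SimpleGraph V} {s : ℕ} (hs : 0 < s)
    (h : AdmitsAllOfOrder G s) : Fintype.card V ≤ s := by
  have : NeZero s := ⟨hs.ne'⟩
  obtain ⟨f, hf⟩ := h (ZMod s) (by simp)
  simpa using Fintype.card_le_of_injective _ hf

end GroupIrregularity

theorem theorem4 {V : Type*} [Fintype V] [Nonempty V] (G : SimpleGraph V)
    (hdisc : ¬ G.Connected)
    (hfour : ∀ c : G.ConnectedComponent, 4 ∣ c.supp.ncard)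
    (hbip : ∀ (c : G.ConnectedComponent) (κ : c.toSimpleGraph.Coloring Bool) (b : Bool),
      Even (κ.colorClass b).ncard) :
    GroupIrregularity.groupIrregularityStrength G = (Fintype.card V : ℕ∞) := by
  apply le_antisymm
  · exact iInf₂_le _ ⟨Fintype.card_pos,
      GroupIrregularity.admitsAllOfOrder_card G hfour hbip⟩
  · exact le_iInf₂ fun s hs => Nat.cast_le.2 (hs.2.card_le hs.1)
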